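/- Let $d\ge 1$ be an integer, let $(\boldsymbol\alpha,\beta)=(\alpha_1,\dots,\alpha_d,\beta)\in(0,\infty)^{d+1}$, and write $$\|\boldsymbol\alpha\|_1=\sum_{i=1}^d\alpha_i,\qquad \boldsymbol r=\frac{\boldsymbol\alpha}{\|\boldsymbol\alpha\|_1+\beta}\in\mathbb R^d,\qquad r_{d+1}=1-\sum_{i=1}^d r_i=\frac{\beta}{\|\boldsymbol\alpha\|_1+\beta},$$ $$\Sigma_{\boldsymbol r}=\mathrm{diag}(\boldsymbol r)-\boldsymbol r\boldsymbol r^{\top},\qquad \varepsilon_N=\frac{1}{N(\|\boldsymbol\alpha\|_1+\beta)}\quad(N\in\mathbb N).$$ Let $\mathbb P_N$ be the $\mathrm{Dirichlet}(N\boldsymbol\alpha,N\beta)$ distribution, i.e. the probability measure on $\mathbb R^d$ with Lebesgue density $$\frac{\Gamma(N\|\boldsymbol\alpha\|_1+N\beta)}{\Gamma(N\beta)\prod_{i=1}^d\Gamma(N\alpha_i)}\Big(1-\sum_{i=1}^d x_i\Big)^{N\beta-1}\prod_{i=1}^d x_i^{N\alpha_i-1}$$ on the simplex $\{\boldsymbol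 x\in[0,1]^d:\sum_{i=1}^d x_i\le 1\}$ and $0$ elsewhere, and let $\mathbb Q_N$ be the normal distribution on $\mathbb R^d$ with mean $\boldsymbol r$ and covariance matrix $(1+\varepsilon_N^{-1})^{-1}\Sigma_{\boldsymbol r}$. Let $\|\mathbb P_N-\mathbb Q_N\|=\sup_A|\mathbb P_N(A)-\mathbb Q_N(A)|$ be the total variation distance, the supremum being over Borel sets $A$. Then there is a universal constant $C>0$, independent of $d$, $\boldsymbol\alpha$, $\beta$, such that for all $d$, $\boldsymbol\alpha$, $\beta$ as above there is an $N_0=N_0(d,\boldsymbol\alpha,\beta)$ with $$\|\mathbb P_N-\mathbb Q_N\|\le C\,\varepsilon_N^{1/2}\,d\,\sqrt{\frac{\max_{1\le i\le d+1}r_i}{\min_{1\le i\le d+1}r_i}}\qquad\text{for all }N\ge N_0.$$ -/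

import Mathlib

open MeasureTheory ProbabilityTheory Filter
open scoped ENNReal

noncomputable section

/-- The `d`-dimensional simplex `{x ∈ [0,1]^d : ‖x‖₁ ≤ 1}`; on `[0,1]^d` the `ℓ¹` norm is the sum
of the coordinates. -/
def simplex (d : ℕ) : Set (EuclideanSpace ℝ (Fin d)) :=
  {x | (∀ i, x i ∈ Set.Icc (0 : ℝ) 1) ∧ ∑ i, x i ≤ 1}

/-- The density on `ℝ^d` of the `Dirichlet(a, b)` distribution with `a ∈ (0,∞)^d`, `b > 0`,
extended by `0` outside the simplex. -/
def dirichletDensity {d : ℕ} (a : Fin d → ℝ) (b : ℝ) : EuclideanSpace ℝ (Fin d) → ℝ :=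
  (simplex d).indicator fun x =>
    Real.Gamma (∑ i, a i + b) / (Real.Gamma b * ∏ i, Real.Gamma (a i))
      * (1 - ∑ i, x i) ^ (b - 1) * ∏ i, x i ^ (a i - 1)

/-- The `Dirichlet(a, b)` distribution on `ℝ^d`. -/
def dirichletMeasure {d : ℕ} (a : Fin d → ℝ) (b : ℝ) : Measure (EuclideanSpace ℝ (Fin d)) :=
  volume.withDensity fun x => ENNReal.ofReal (dirichletDensity a b x)

/-- The mean vector `r = α / (‖α‖₁ + β) ∈ ℝ^d`, for positive `α` and `β`. -/
def meanVec {d : ℕ} (α : Fin d → ℝ) (β : ℝ) : Fin d → ℝ :=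
  fun i => α i / (∑ j, α j + β)

/-- The extended vector `(r₁, …, r_d, r_{d+1})` with `r_{d+1} = β / (‖α‖₁ + β)`. -/
def meanVecExt {d : ℕ} (α : Fin d → ℝ) (β : ℝ) : Fin (d + 1) → ℝ :=
  Fin.snoc (α := fun _ => ℝ) (meanVec α β) (β / (∑ j, α j + β))

/-- The matrix `Σ_r = diag(r) - r rᵀ`. -/
def sigmaMat {d : ℕ} (r : Fin d → ℝ) : Matrix (Fin d) (Fin d) ℝ :=
  Matrix.diagonal r - Matrix.vecMulVec r r

/-- `ε_N = 1 / (N (‖α‖₁ + β))`. -/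
def epsN {d : ℕ} (α : Fin d → ℝ) (β : ℝ) (N : ℕ) : ℝ :=
  1 / ((N : ℝ) * (∑ j, α j + β))

/-- The normal distribution on `ℝ^d` with mean `r` and covariance matrix
`(1 + ε_N⁻¹)⁻¹ Σ_r`. -/
def normalApprox {d : ℕ} (α : Fin d → ℝ) (β : ℝ) (N : ℕ) : Measure (EuclideanSpace ℝ (Fin d)) :=
  multivariateGaussian (WithLp.toLp 2 (meanVec α β))
    ((1 + (epsN α β N)⁻¹)⁻¹ • sigmaMat (meanVec α β))

/-- The total variation distance `sup_A |P(A) - Q(A)|` over measurable sets `A`. The subtraction in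
`[0,∞]` is truncated at `0`, so the larger of the two differences is `|P(A) - Q(A)|`. -/
def tvDist {Ω : Type*} [MeasurableSpace Ω] (P Q : Measure Ω) : ℝ≥0∞ :=
  ⨆ (A : Set Ω) (_ : MeasurableSet A), max (P A - Q A) (Q A - P A)

end

/-!
The proof bounds the relative entropy of the Dirichlet distribution with respect to its Gaussian
approximation, and passes to total variation by a Pinsker type inequality
(`tvDist_withDensity_le`).

Write `A = 1 / ε_N` for the total mass, `w₁, …, w_{d+1}` for the barycentric coordinates on the
simplex, and `uᵢ = wᵢ / rᵢ - 1`. Up to a constant, the logarithm of the density ratio is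
`∑ (A rᵢ - 1) log (1 + uᵢ) + (1 + A) / 2 * ∑ rᵢ uᵢ²`, because the inverse of `diag(r) - r rᵀ` is the
quadratic form `∑ rᵢ uᵢ²` over all `d + 1` coordinates (`dotProduct_inv_smul_sigmaMat`). The
coefficients `A rᵢ - 1` are positive for large `N`, and `log (1 + u) ≤ u - u² / 2 + u³ / 3` on the
whole range `u > -1`. Hence the log density ratio is bounded by a cubic polynomial on the entire
simplex (`symmDirichletDensity_le`), and the expectation of that polynomial only involves the first
three moments of the `uᵢ`, which are rational functions of the parameters
(`integral_mul_relDev_pow`). The constant term is controlled by two-sided Stirling bounds for `Γ`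
(`le_stirlingRemainder`, `stirlingRemainder_le`). All terms of order one cancel, since the two
distributions have the same mean and covariance, and the relative entropy is at most
`5 / 4 * ∑ 1 / (A rᵢ)` (`integral_mul_logRatio_le`). Finally `∑ 1 / rᵢ ≤ (d + 1)² max r / min r`
(`sum_one_div_le`).

Two facts are proved along the way: the Dirichlet integral, from the semigroup property of the
kernels `t₊^(a-1) / Γ(a)` under convolution (`lintegral_prod_powKernel`), and the Lebesgue density
of a nondegenerate multivariate Gaussian distribution (`multivariateGaussian_eq_withDensity`).
-/

/-! ### Total variation distance between measures with densities -/

/-- The squared Hellinger integrand is bounded by the relative entropy integrand, up to `q - p`,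
which integrates to zero for probability densities. -/
theorem sub_sqrt_sq_le {p q g : ℝ} (hp : 0 ≤ p) (hq : 0 ≤ q) (h : p ≤ q * Real.exp g) :
    (√p - √q) ^ 2 ≤ q - p + p * g := by
  have h1 : √p ≤ √q * Real.exp (g / 2) := by
    have : Real.exp g = Real.exp (g / 2) ^ 2 := by rw [← Real.exp_nat_mul]; congr 1; push_cast; ring
    rw [← Real.sqrt_sq (Real.exp_pos (g / 2)).le, ← Real.sqrt_mul hq, ← this]
    exact Real.sqrt_le_sqrt h
  have h2 : √p * (1 - g / 2) ≤ √q := by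
    have h3 : 1 - g / 2 ≤ Real.exp (-(g / 2)) := by
      have := Real.add_one_le_exp (-(g / 2)); linarith
    calc √p * (1 - g / 2) ≤ √p * Real.exp (-(g / 2)) := by gcongr
      _ ≤ √q * Real.exp (g / 2) * Real.exp (-(g / 2)) := by gcongr
      _ = √q := by rw [mul_assoc, ← Real.exp_add]; simp
  have h4 := mul_le_mul_of_nonneg_left h2 (Real.sqrt_nonneg p)
  have h5 : √p * (√p * (1 - g / 2)) = p * (1 - g / 2) := by
    rw [← mul_assoc, Real.mul_self_sqrt hp]
  nlinarith [Real.mul_self_sqrt hp, Real.mul_self_sqrt hq]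

/-- The Cauchy–Schwarz step from Hellinger to total variation distance, in pointwise form with a
free parameter `t`. -/
theorem abs_sub_le_of_sub_sqrt_sq_le {p q t h : ℝ} (hp : 0 ≤ p) (hq : 0 ≤ q) (ht : 0 < t)
    (hh : (√p - √q) ^ 2 ≤ h) : |p - q| ≤ h / (2 * t) + t * (p + q) := by
  have e1 := Real.mul_self_sqrt hp
  have e2 := Real.mul_self_sqrt hq
  have h1 : |p - q| = |√p - √q| * (√p + √q) := by
    rw [← abs_of_nonneg (add_nonneg (Real.sqrt_nonneg p) (Real.sqrt_nonneg q)), ← abs_mul]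
    congr 1; nlinarith
  have h2 : |√p - √q| * (√p + √q) ≤ (|√p - √q|) ^ 2 / (2 * t) + t * ((√p + √q) ^ 2 / 2) := by
    rw [div_add' _ _ _ (by positivity), le_div_iff₀ (by positivity)]
    nlinarith [sq_nonneg (|√p - √q| - t * (√p + √q))]
  have h3 : (√p + √q) ^ 2 / 2 ≤ p + q := by nlinarith [sq_nonneg (√p - √q)]
  rw [h1]
  refine h2.trans (add_le_add ?_ ?_)
  · rw [sq_abs]; gcongr
  · gcongr

/-- A Pinsker type inequality: if `log (p / q) ≤ g`, then the expectation of `g` under `p` controls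
the square of the total variation distance. The hypothesis is stated with `exp` so that it makes
sense where `p` vanishes. -/
theorem tvDist_withDensity_le {Ω : Type*} [MeasurableSpace Ω] {μ : Measure Ω} {p q g : Ω → ℝ}
    {K : ℝ} (hp : ∀ x, 0 ≤ p x) (hq : ∀ x, 0 ≤ q x)
    (hpi : Integrable p μ) (hqi : Integrable q μ) (hp1 : ∫ x, p x ∂μ = 1) (hq1 : ∫ x, q x ∂μ = 1)
    (hg : ∀ x, p x ≤ q x * Real.exp (g x)) (hgi : Integrable (fun x => p x * g x) μ)
    (hK0 : 0 < K) (hK : ∫ x, p x * g x ∂μ ≤ K) :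
    tvDist (μ.withDensity fun x => ENNReal.ofReal (p x))
      (μ.withDensity fun x => ENNReal.ofReal (q x)) ≤ ENNReal.ofReal (2 * √K) := by
  have hL1 : ∫ x, |p x - q x| ∂μ ≤ 2 * √K := by
    have hs : 0 < √K := Real.sqrt_pos.2 hK0
    -- the choice `t = √K / 2` balances the two terms of `abs_sub_le_of_sub_sqrt_sq_le`
    have key : ∫ x, |p x - q x| ∂μ ≤
        ∫ x, ((q x - p x + p x * g x) / (2 * (√K / 2)) + √K / 2 * (p x + q x)) ∂μ := by
      refine integral_mono (hpi.sub hqi).abs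
        ((((hqi.sub hpi).add hgi).div_const _).add ((hpi.add hqi).const_mul _)) fun x => ?_
      exact abs_sub_le_of_sub_sqrt_sq_le (hp x) (hq x) (by positivity)
        (sub_sqrt_sq_le (hp x) (hq x) (hg x))
    have e : ∫ x, ((q x - p x + p x * g x) / (2 * (√K / 2)) + √K / 2 * (p x + q x)) ∂μ =
        (∫ x, p x * g x ∂μ) / √K + √K := by
      have i1 : Integrable (fun x => q x - p x) μ := hqi.sub hpi
      have i2 : Integrable (fun x => q x - p x + p x * g x) μ := i1.add hgi
      have i3 : Integrable (fun x => p x + q x) μ := hpi.add hqi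
      rw [integral_add (i2.div_const _) (i3.const_mul _),
        integral_div, integral_const_mul, integral_add i1 hgi, integral_sub hqi hpi,
        integral_add hpi hqi, hp1, hq1]
      field_simp
      ring
    rw [e] at key
    refine key.trans ?_
    have : (∫ x, p x * g x ∂μ) / √K ≤ √K := by
      rw [div_le_iff₀ hs, Real.mul_self_sqrt hK0.le]; exact hK
    linarith
  have main : ∀ (f h : Ω → ℝ), (∀ x, 0 ≤ f x) → (∀ x, 0 ≤ h x) → Integrable f μ → Integrable h μ →
      (∫ x, |f x - h x| ∂μ ≤ 2 * √K) → ∀ A, MeasurableSet A →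
      (μ.withDensity fun x => ENNReal.ofReal (f x)) A -
        (μ.withDensity fun x => ENNReal.ofReal (h x)) A ≤ ENNReal.ofReal (2 * √K) := by
    intro f h hf hh hfi hhi hb A hA
    rw [withDensity_apply _ hA, withDensity_apply _ hA, tsub_le_iff_right]
    calc ∫⁻ x in A, ENNReal.ofReal (f x) ∂μ
        ≤ ∫⁻ x in A, (ENNReal.ofReal |f x - h x| + ENNReal.ofReal (h x)) ∂μ := by
          refine lintegral_mono fun x => ?_
          rw [← ENNReal.ofReal_add (abs_nonneg _) (hh x)]
          exact ENNReal.ofReal_le_ofReal (by linarith [le_abs_self (f x - h x)])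
      _ = ∫⁻ x in A, ENNReal.ofReal |f x - h x| ∂μ + ∫⁻ x in A, ENNReal.ofReal (h x) ∂μ :=
          lintegral_add_right' _ hhi.aemeasurable.ennreal_ofReal.restrict
      _ ≤ ∫⁻ x, ENNReal.ofReal |f x - h x| ∂μ + ∫⁻ x in A, ENNReal.ofReal (h x) ∂μ := by
          gcongr; exact Measure.restrict_le_self
      _ ≤ _ := by
          gcongr
          have i4 : Integrable (fun x => |f x - h x|) μ := (hfi.sub hhi).abs
          rw [← ofReal_integral_eq_lintegral_ofReal i4
            (ae_of_all _ fun x => abs_nonneg _)]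
          exact ENNReal.ofReal_le_ofReal hb
  refine iSup₂_le fun A hA => max_le ?_ ?_
  · exact main p q hp hq hpi hqi hL1 A hA
  · refine main q p hq hp hqi hpi ?_ A hA
    simpa only [abs_sub_comm] using hL1

/-! ### Stirling bounds for the Gamma function -/

/-- The remainder `log Γ(x) - (x - 1/2) log x + x` in Stirling's formula, which tends to
`log (2π) / 2`. -/
noncomputable def stirlingRemainder (x : ℝ) : ℝ :=
  Real.log (Real.Gamma x) - (x - 1 / 2) * Real.log x + x

theorem one_le_mul_log_one_add_inv {x : ℝ} (hx : 0 < x) : 1 ≤ (x + 1 / 2) * Real.log (1 + x⁻¹) := by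
  have h := (Real.hasSum_log_one_add_inv hx).mul_left (x + 1 / 2)
  have := le_hasSum h 0 (fun k _ => by positivity)
  refine le_trans (le_of_eq ?_) this
  simp; field_simp

theorem mul_log_one_add_inv_le {x : ℝ} (hx : 0 < x) :
    (x + 1 / 2) * Real.log (1 + x⁻¹) ≤ 1 + (1 / (12 * x) - 1 / (12 * (x + 1))) := by
  have h := (Real.hasSum_log_one_add_inv hx).mul_left (x + 1 / 2)
  set t : ℝ := 1 / (2 * x + 1) with ht
  have ht0 : 0 < t := by positivity
  have ht1 : t ^ 2 < 1 := by
    rw [ht, div_pow, one_pow, div_lt_one (by positivity)]; nlinarith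
  have hx2 : (x + 1 / 2) * 2 * t = 1 := by rw [ht]; field_simp
  -- the series is `1 + t² / 3 + t⁴ / 5 + …`; bounding `1 / (2k + 1)` by `1 / 3` for `k ≥ 1` makes it
  -- geometric, with `t² / (1 - t²) = 1 / (4 x (x + 1))`, which telescopes
  have hg := (hasSum_geometric_of_lt_one (sq_nonneg t) ht1).mul_left (1 / 3)
  have hg2 := hg.add (hasSum_ite_eq (0 : ℕ) (2 / 3 : ℝ))
  have := hasSum_le (fun k => ?_) h hg2
  · refine this.trans (le_of_eq ?_)
    have : 1 - t ^ 2 = 4 * x * (x + 1) / (2 * x + 1) ^ 2 := by rw [ht]; field_simp; ring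
    rw [this]; field_simp; ring
  · have e : (x + 1 / 2) * (2 * (1 / (2 * (k : ℝ) + 1)) * t ^ (2 * k + 1)) =
        1 / (2 * (k : ℝ) + 1) * (t ^ 2) ^ k := by
      rw [pow_succ, pow_mul]; linear_combination (1 / (2 * (k : ℝ) + 1) * (t ^ 2) ^ k) * hx2
    rw [e]
    rcases Nat.eq_zero_or_pos k with rfl | hk
    · norm_num
    · have hk1 : (1 : ℝ) ≤ k := by exact_mod_cast hk
      rw [if_neg hk.ne', add_zero]
      gcongr
      linarith

theorem stirlingRemainder_sub_add_one {x : ℝ} (hx : 0 < x) :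
    stirlingRemainder x - stirlingRemainder (x + 1) = (x + 1 / 2) * Real.log (1 + x⁻¹) - 1 := by
  have e : Real.log (1 + x⁻¹) = Real.log (x + 1) - Real.log x := by
    rw [← Real.log_div (by positivity) hx.ne']; congr 1; field_simp
  rw [stirlingRemainder, stirlingRemainder, Real.Gamma_add_one hx.ne',
    Real.log_mul hx.ne' (Real.Gamma_pos_of_pos hx).ne', e]
  ring

/-- The value of the limit comes from Euler's limit formula for `log Γ` and Stirling's formula for
factorials. -/
theorem tendsto_stirlingRemainder_add_nat {x : ℝ} (hx : 0 < x) :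
    Tendsto (fun n : ℕ => stirlingRemainder (x + (n + 1 : ℕ))) atTop
      (nhds (Real.log (2 * Real.pi) / 2)) := by
  have h1 := (Real.BohrMollerup.tendsto_log_gamma hx)
  have h2 : Tendsto (fun n : ℕ => Real.log (Stirling.stirlingSeq n)) atTop
      (nhds (Real.log √Real.pi)) :=
    Stirling.tendsto_stirlingSeq_sqrt_pi.log (by positivity)
  have h3 : Tendsto (fun n : ℕ => (n : ℝ) * Real.log (1 + (x + 1) / n)) atTop (nhds (x + 1)) :=
    (Real.tendsto_mul_log_one_add_div_atTop (x + 1)).comp tendsto_natCast_atTop_atTop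
  have h4 : Tendsto (fun n : ℕ => (x + 1 / 2) * Real.log (1 + (x + 1) / n)) atTop
      (nhds ((x + 1 / 2) * Real.log (1 + 0))) := by
    refine Tendsto.const_mul _ (Tendsto.log ?_ (by norm_num))
    exact tendsto_const_nhds.add (tendsto_const_nhds.div_atTop tendsto_natCast_atTop_atTop)
  have h := (((h1.const_sub (Real.log (Real.Gamma x))).add h2).sub (h3.add h4)).add_const
    (Real.log 2 / 2 + x + 1)
  have hlim : Real.log (Real.Gamma x) - Real.log (Real.Gamma x) + Real.log √Real.pi -
      (x + 1 + (x + 1 / 2) * Real.log (1 + 0)) + (Real.log 2 / 2 + x + 1) =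
      Real.log (2 * Real.pi) / 2 := by
    rw [Real.log_sqrt Real.pi_pos.le, Real.log_mul two_ne_zero Real.pi_ne_zero]
    simp; ring
  rw [hlim] at h
  refine h.congr' ?_
  filter_upwards [eventually_gt_atTop 0] with n hn
  have hn0 : (0 : ℝ) < n := by exact_mod_cast hn
  have hf := Real.BohrMollerup.f_add_nat_eq (f := Real.log ∘ Real.Gamma)
    (fun {y} hy => by
      simp only [Function.comp_apply]
      rw [Real.Gamma_add_one hy.ne', Real.log_mul hy.ne' (Real.Gamma_pos_of_pos hy).ne', add_comm])
    hx (n + 1)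
  simp only [Function.comp_apply] at hf
  have hl : Real.log (1 + (x + 1) / n) = Real.log (x + (n + 1 : ℕ)) - Real.log n := by
    rw [← Real.log_div (by positivity) hn0.ne']; congr 1; push_cast; field_simp; ring
  rw [stirlingRemainder, hf, Real.BohrMollerup.logGammaSeq, Stirling.log_stirlingSeq_formula, hl,
    Real.log_mul two_ne_zero hn0.ne', Real.log_div hn0.ne' (Real.exp_pos 1).ne', Real.log_exp]
  push_cast
  ring

theorem le_stirlingRemainder {x : ℝ} (hx : 0 < x) :
    Real.log (2 * Real.pi) / 2 ≤ stirlingRemainder x := by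
  have h : ∀ n : ℕ, stirlingRemainder (x + n) ≤ stirlingRemainder x := by
    intro n
    induction n with
    | zero => simp
    | succ n ih =>
      have hxn : 0 < x + n := by positivity
      have := stirlingRemainder_sub_add_one hxn
      have := one_le_mul_log_one_add_inv hxn
      push_cast
      rw [← add_assoc]
      linarith
  exact le_of_tendsto (tendsto_stirlingRemainder_add_nat hx) (Eventually.of_forall fun n => h _)

theorem stirlingRemainder_le {x : ℝ} (hx : 0 < x) :
    stirlingRemainder x ≤ Real.log (2 * Real.pi) / 2 + 1 / (12 * x) := by
  have h : ∀ n : ℕ, stirlingRemainder x ≤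
      stirlingRemainder (x + n) + (1 / (12 * x) - 1 / (12 * (x + n))) := by
    intro n
    induction n with
    | zero => simp
    | succ n ih =>
      have hxn : 0 < x + n := by positivity
      have := stirlingRemainder_sub_add_one hxn
      have := mul_log_one_add_inv_le hxn
      push_cast
      rw [← add_assoc]
      linarith
  refine ge_of_tendsto ((tendsto_stirlingRemainder_add_nat hx).add_const (1 / (12 * x)))
    (Eventually.of_forall fun n => (h (n + 1)).trans ?_)
  have : (0 : ℝ) ≤ 1 / (12 * (x + (n + 1 : ℕ))) := by positivity
  linarith

/-! ### The Dirichlet integral and the moments of the Dirichlet distribution -/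

/-- The kernel `t₊^(a-1) / Γ(a)` of the Riemann–Liouville fractional integral of order `a`. -/
noncomputable def powKernel (a t : ℝ) : ℝ≥0∞ :=
  if 0 < t then ENNReal.ofReal (t ^ (a - 1) / Real.Gamma a) else 0

@[fun_prop]
theorem measurable_powKernel (a : ℝ) : Measurable (powKernel a) :=
  Measurable.ite measurableSet_Ioi (by fun_prop) (by fun_prop)

/-- The kernels form a convolution semigroup; this is the Beta integral. -/
theorem lintegral_powKernel_mul {a b : ℝ} (ha : 0 < a) (hb : 0 < b) (s : ℝ) :
    ∫⁻ x, powKernel a x * powKernel b (s - x) = powKernel (a + b) s := by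
  have hGa := Real.Gamma_pos_of_pos ha
  have hGb := Real.Gamma_pos_of_pos hb
  have hGab := Real.Gamma_pos_of_pos (add_pos ha hb)
  rcases le_or_gt s 0 with hs | hs
  · have : ∀ x, powKernel a x * powKernel b (s - x) = 0 := by
      intro x
      rcases le_or_gt x 0 with hx | hx
      · simp [powKernel, hx.not_gt]
      · simp [powKernel, show ¬ x < s by linarith]
    rw [lintegral_congr this, lintegral_zero, powKernel, if_neg hs.not_gt]
  · have h1 := Real.smul_map_volume_mul_left hs.ne'
    rw [← h1, lintegral_smul_measure, lintegral_map (by fun_prop) (by fun_prop)]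
    have h2 : ∀ y, powKernel a (s * y) * powKernel b (s - s * y) =
        ENNReal.ofReal (s ^ (a + b - 2) / Real.Gamma (a + b)) * betaPDF a b y := by
      intro y
      have e1 : 0 < s * y ↔ 0 < y := by simp [hs]
      have e2 : 0 < s - s * y ↔ y < 1 := by
        rw [show s - s * y = s * (1 - y) by ring]; simp [hs]
      by_cases hy : 0 < y
      · by_cases hy1 : y < 1
        · rw [powKernel, powKernel, if_pos (e1.2 hy), if_pos (e2.2 hy1),
            betaPDF_of_pos_lt_one hy hy1, ← ENNReal.ofReal_mul (by positivity),
            ← ENNReal.ofReal_mul (by positivity)]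
          congr 1
          have hy2 : 0 ≤ 1 - y := by linarith
          rw [show s - s * y = s * (1 - y) by ring, Real.mul_rpow hs.le hy.le,
            Real.mul_rpow hs.le hy2, beta, show a + b - 2 = (a - 1) + (b - 1) by ring,
            Real.rpow_add hs]
          field_simp
        · rw [betaPDF_eq_zero_of_one_le (not_lt.1 hy1), powKernel, powKernel,
            if_neg (fun h => hy1 (e2.1 h)), mul_zero, mul_zero]
      · rw [betaPDF_eq_zero_of_nonpos (not_lt.1 hy), powKernel, if_neg (fun h => hy (e1.1 h)),
          zero_mul, mul_zero]
    simp_rw [h2]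
    have hm : Measurable (betaPDF a b) := (measurable_betaPDFReal a b).ennreal_ofReal
    rw [lintegral_const_mul _ hm, lintegral_betaPDF_eq_one ha hb, mul_one, smul_eq_mul,
      ← ENNReal.ofReal_mul (abs_nonneg _), powKernel, if_pos hs, abs_of_pos hs]
    congr 1
    rw [show a + b - 1 = (a + b - 2) + 1 by ring, Real.rpow_add_one hs.ne']
    ring

/-- The Dirichlet integral over the simplex of size `s`. Scaling by `s` is part of the statement so
that the induction on `d`, which integrates out one coordinate at a time, goes through. -/
theorem lintegral_prod_powKernel : ∀ {d : ℕ} (a : Fin d → ℝ) (b s : ℝ), (∀ i, 0 < a i) → 0 < b →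
    ∫⁻ x : Fin d → ℝ, (∏ i, powKernel (a i) (x i)) * powKernel b (s - ∑ i, x i) =
      powKernel (∑ i, a i + b) s
  | 0, a, b, s, _, _ => by
    rw [lintegral_unique]
    simp [volume_pi]
  | d + 1, a, b, s, ha, hb => by
    have hA : 0 < ∑ i : Fin d, a i.succ + b :=
      add_pos_of_nonneg_of_pos (Finset.sum_nonneg fun i _ => (ha _).le) hb
    rw [← ((volume_preserving_piFinSuccAbove (fun _ : Fin (d + 1) => ℝ) 0).symm).lintegral_comp
      (by fun_prop)]
    rw [Measure.volume_eq_prod, lintegral_prod _ (by fun_prop)]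
    rw [Fin.sum_univ_succ, add_assoc, ← lintegral_powKernel_mul (ha 0) hA]
    refine lintegral_congr fun x => ?_
    rw [← lintegral_prod_powKernel (fun i => a i.succ) b (s - x) (fun i => ha _) hb,
      ← lintegral_const_mul _ (by fun_prop)]
    refine lintegral_congr fun y => ?_
    simp [MeasurableEquiv.piFinSuccAbove_symm_apply, Fin.prod_univ_succ, Fin.sum_univ_succ,
      Fin.insertNthEquiv, mul_assoc, sub_sub]

/-- The barycentric coordinates `(x₁, …, x_d, 1 - ∑ xᵢ)`. -/
noncomputable def baryCoord {d : ℕ} (x : EuclideanSpace ℝ (Fin d)) : Fin (d + 1) → ℝ :=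
  Fin.snoc (α := fun _ => ℝ) (fun i => x i) (1 - ∑ i, x i)

/-- The Dirichlet density with all `d + 1` parameters in one vector, written symmetrically in the
barycentric coordinates. -/
noncomputable def symmDirichletDensity {d : ℕ} (c : Fin (d + 1) → ℝ) :
    EuclideanSpace ℝ (Fin d) → ℝ :=
  (simplex d).indicator fun x =>
    Real.Gamma (∑ i, c i) / (∏ i, Real.Gamma (c i)) * ∏ i, baryCoord x i ^ (c i - 1)

theorem dirichletDensity_eq_symm {d : ℕ} (a : Fin d → ℝ) (b : ℝ) :
    dirichletDensity a b = symmDirichletDensity (Fin.snoc (α := fun _ => ℝ) a b) := by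
  unfold dirichletDensity symmDirichletDensity
  congr 1
  ext x
  simp only [Fin.sum_univ_castSucc, Fin.prod_univ_castSucc, baryCoord, Fin.snoc_castSucc,
    Fin.snoc_last]
  ring

theorem baryCoord_nonneg {d : ℕ} {x : EuclideanSpace ℝ (Fin d)} (hx : x ∈ simplex d)
    (i : Fin (d + 1)) : 0 ≤ baryCoord x i := by
  refine Fin.lastCases ?_ (fun i => ?_) i
  · simpa [baryCoord] using hx.2
  · simpa [baryCoord] using (hx.1 i).1

theorem mem_simplex_of_baryCoord_nonneg {d : ℕ} {x : EuclideanSpace ℝ (Fin d)}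
    (h : ∀ i, 0 ≤ baryCoord x i) : x ∈ simplex d := by
  have h0 : ∀ i, 0 ≤ x i := fun i => by simpa [baryCoord] using h i.castSucc
  have h1 : ∑ i, x i ≤ 1 := by simpa [baryCoord] using h (Fin.last d)
  exact ⟨fun i => ⟨h0 i, (Finset.single_le_sum (fun j _ => h0 j) (Finset.mem_univ i)).trans h1⟩, h1⟩

theorem baryCoord_le_one {d : ℕ} {x : EuclideanSpace ℝ (Fin d)} (hx : x ∈ simplex d)
    (i : Fin (d + 1)) : baryCoord x i ≤ 1 := by
  refine Fin.lastCases ?_ (fun i => ?_) i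
  · simpa [baryCoord] using Finset.sum_nonneg fun i _ => (hx.1 i).1
  · simpa [baryCoord] using (hx.1 i).2

@[fun_prop]
theorem measurable_baryCoord {d : ℕ} (i : Fin (d + 1)) :
    Measurable fun x : EuclideanSpace ℝ (Fin d) => baryCoord x i := by
  refine Fin.lastCases ?_ (fun i => ?_) i
  · simp only [baryCoord, Fin.snoc_last]; fun_prop
  · simp only [baryCoord, Fin.snoc_castSucc]; fun_prop

theorem measurableSet_simplex (d : ℕ) : MeasurableSet (simplex d) := by
  have : simplex d = ⋂ i, {x | 0 ≤ baryCoord x i} := by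
    ext x
    simp only [Set.mem_iInter, Set.mem_ofPred_eq]
    exact ⟨baryCoord_nonneg, mem_simplex_of_baryCoord_nonneg⟩
  rw [this]
  exact MeasurableSet.iInter fun i => measurableSet_le measurable_const (measurable_baryCoord i)

@[fun_prop]
theorem measurable_symmDirichletDensity {d : ℕ} (c : Fin (d + 1) → ℝ) :
    Measurable (symmDirichletDensity c) := by
  refine Measurable.indicator ?_ (measurableSet_simplex d)
  exact (Finset.measurable_prod _ fun i _ => (measurable_baryCoord i).pow_const _).const_mul _

theorem symmDirichletDensity_nonneg {d : ℕ} {c : Fin (d + 1) → ℝ} (hc : ∀ i, 0 < c i)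
    (x : EuclideanSpace ℝ (Fin d)) : 0 ≤ symmDirichletDensity c x := by
  refine Set.indicator_nonneg (fun x hx => ?_) x
  have := Real.Gamma_pos_of_pos (Finset.sum_pos (fun i _ => hc i) Finset.univ_nonempty)
  exact mul_nonneg (div_nonneg this.le (Finset.prod_nonneg fun i _ =>
    (Real.Gamma_pos_of_pos (hc i)).le))
    (Finset.prod_nonneg fun i _ => Real.rpow_nonneg (baryCoord_nonneg hx i) _)

/-- For parameters above `1` the density vanishes on the boundary of the simplex, so that it agrees
with the product of kernels everywhere. -/
theorem ofReal_symmDirichletDensity {d : ℕ} {c : Fin (d + 1) → ℝ} (hc : ∀ i, 1 < c i)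
    (x : EuclideanSpace ℝ (Fin d)) :
    ENNReal.ofReal (symmDirichletDensity c x) =
      ENNReal.ofReal (Real.Gamma (∑ i, c i)) * ∏ i, powKernel (c i) (baryCoord x i) := by
  have hG : ∀ i, 0 < Real.Gamma (c i) := fun i => Real.Gamma_pos_of_pos (by linarith [hc i])
  have hS : 0 < Real.Gamma (∑ i, c i) := Real.Gamma_pos_of_pos
    (Finset.sum_pos (fun i _ => by linarith [hc i]) Finset.univ_nonempty)
  by_cases h : ∀ i, 0 < baryCoord x i
  · rw [symmDirichletDensity, Set.indicator_of_mem
      (mem_simplex_of_baryCoord_nonneg fun i => (h i).le)]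
    simp only [powKernel, h, if_true]
    rw [← ENNReal.ofReal_prod_of_nonneg
      (fun i _ => div_nonneg (Real.rpow_nonneg (h i).le _) (hG i).le), ← ENNReal.ofReal_mul hS.le,
      Finset.prod_div_distrib]
    congr 1
    ring
  · push Not at h
    obtain ⟨i, hi⟩ := h
    rw [Finset.prod_eq_zero (Finset.mem_univ i) (by simp [powKernel, hi.not_gt]), mul_zero]
    by_cases hx : x ∈ simplex d
    · rw [symmDirichletDensity, Set.indicator_of_mem hx,
        Finset.prod_eq_zero (f := fun i => baryCoord x i ^ (c i - 1)) (Finset.mem_univ i), mul_zero,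
        ENNReal.ofReal_zero]
      rw [le_antisymm hi (baryCoord_nonneg hx i), Real.zero_rpow (by linarith [hc i])]
    · rw [symmDirichletDensity, Set.indicator_of_notMem hx, ENNReal.ofReal_zero]

theorem lintegral_symmDirichletDensity {d : ℕ} {c : Fin (d + 1) → ℝ} (hc : ∀ i, 1 < c i) :
    ∫⁻ x, ENNReal.ofReal (symmDirichletDensity c x) = 1 := by
  have hS : 0 < Real.Gamma (∑ i, c i) := Real.Gamma_pos_of_pos
    (Finset.sum_pos (fun i _ => by linarith [hc i]) Finset.univ_nonempty)
  simp_rw [ofReal_symmDirichletDensity hc, Fin.prod_univ_castSucc, baryCoord, Fin.snoc_castSucc,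
    Fin.snoc_last]
  have hm : Measurable fun x : Fin d → ℝ =>
      (∏ i, powKernel (c i.castSucc) (x i)) * powKernel (c (Fin.last d)) (1 - ∑ i, x i) := by
    fun_prop
  have := (PiLp.volume_preserving_ofLp (Fin d)).lintegral_comp hm
  rw [lintegral_const_mul _ (by fun_prop), this, lintegral_prod_powKernel _ _ _
    (fun i => by linarith [hc i.castSucc]) (by linarith [hc (Fin.last d)]), ← Fin.sum_univ_castSucc,
    powKernel, if_pos one_pos, ← ENNReal.ofReal_mul hS.le, Real.one_rpow,
    mul_one_div_cancel hS.ne', ENNReal.ofReal_one]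

theorem integrable_symmDirichletDensity {d : ℕ} {c : Fin (d + 1) → ℝ} (hc : ∀ i, 1 < c i) :
    Integrable (symmDirichletDensity c) := by
  refine ⟨(measurable_symmDirichletDensity c).aestronglyMeasurable, ?_⟩
  rw [hasFiniteIntegral_iff_ofReal (ae_of_all _ (symmDirichletDensity_nonneg fun i => by
    linarith [hc i])), lintegral_symmDirichletDensity hc]
  exact ENNReal.one_lt_top

theorem integral_symmDirichletDensity {d : ℕ} {c : Fin (d + 1) → ℝ} (hc : ∀ i, 1 < c i) :
    ∫ x, symmDirichletDensity c x = 1 := by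
  rw [integral_eq_lintegral_of_nonneg_ae (ae_of_all _ (symmDirichletDensity_nonneg fun i => by
    linarith [hc i])) (measurable_symmDirichletDensity c).aestronglyMeasurable,
    lintegral_symmDirichletDensity hc, ENNReal.toReal_one]

/-- Multiplying the density by a coordinate raises the matching parameter by one; this is what
reduces all moments to the normalisation. -/
theorem symmDirichletDensity_mul_baryCoord {d : ℕ} {c : Fin (d + 1) → ℝ} (hc : ∀ i, 0 < c i)
    (i : Fin (d + 1)) (x : EuclideanSpace ℝ (Fin d)) :
    symmDirichletDensity c x * baryCoord x i =
      c i / (∑ j, c j) * symmDirichletDensity (c + Pi.single i 1) x := by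
  by_cases hx : x ∈ simplex d
  · have hA : 0 < ∑ j, c j := Finset.sum_pos (fun i _ => hc i) Finset.univ_nonempty
    have e1 : ∑ j, (c + Pi.single i 1 : Fin (d + 1) → ℝ) j = ∑ j, c j + 1 := by
      simp [Finset.sum_add_distrib]
    have e2 : ∏ j, Real.Gamma ((c + Pi.single i 1 : Fin (d + 1) → ℝ) j) =
        c i * ∏ j, Real.Gamma (c j) := by
      rw [← Finset.mul_prod_erase _ _ (Finset.mem_univ i),
        ← Finset.mul_prod_erase Finset.univ (fun j => Real.Gamma (c j)) (Finset.mem_univ i)]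
      rw [Pi.add_apply, Pi.single_eq_same, Real.Gamma_add_one (hc i).ne', mul_assoc]
      congr 2
      refine Finset.prod_congr rfl fun j hj => ?_
      rw [Pi.add_apply, Pi.single_eq_of_ne (Finset.ne_of_mem_erase hj), add_zero]
    have e3 : ∏ j, baryCoord x j ^ ((c + Pi.single i 1 : Fin (d + 1) → ℝ) j - 1) =
        (∏ j, baryCoord x j ^ (c j - 1)) * baryCoord x i := by
      rw [← Finset.mul_prod_erase _ _ (Finset.mem_univ i),
        ← Finset.mul_prod_erase Finset.univ (fun j => baryCoord x j ^ (c j - 1))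
          (Finset.mem_univ i)]
      have : ∏ j ∈ Finset.univ.erase i,
          baryCoord x j ^ ((c + Pi.single i 1 : Fin (d + 1) → ℝ) j - 1) =
          ∏ j ∈ Finset.univ.erase i, baryCoord x j ^ (c j - 1) := by
        refine Finset.prod_congr rfl fun j hj => ?_
        rw [Pi.add_apply, Pi.single_eq_of_ne (Finset.ne_of_mem_erase hj), add_zero]
      rw [this, Pi.add_apply, Pi.single_eq_same,
        show c i + 1 - 1 = c i - 1 + 1 by ring, Real.rpow_add_one' (baryCoord_nonneg hx i)
          (by linarith [hc i])]
      ring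
    have hP : ∏ j, Real.Gamma (c j) ≠ 0 :=
      Finset.prod_ne_zero_iff.2 fun j _ => (Real.Gamma_pos_of_pos (hc j)).ne'
    rw [symmDirichletDensity, symmDirichletDensity, Set.indicator_of_mem hx,
      Set.indicator_of_mem hx, e1, e2, e3, Real.Gamma_add_one hA.ne']
    have := (hc i).ne'
    field_simp
  · simp [symmDirichletDensity, hx]

theorem one_lt_add_single {d : ℕ} {c : Fin (d + 1) → ℝ} (hc : ∀ i, 1 < c i) (i j : Fin (d + 1)) :
    1 < (c + Pi.single i 1 : Fin (d + 1) → ℝ) j := by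
  have : (0 : ℝ) ≤ Pi.single (M := fun _ => ℝ) i 1 j := by
    rw [Pi.single_apply]; split_ifs <;> norm_num
  rw [Pi.add_apply]; linarith [hc j]

theorem integral_mul_baryCoord_pow_succ {d : ℕ} {c : Fin (d + 1) → ℝ} (hc : ∀ i, 1 < c i)
    (i : Fin (d + 1)) (k : ℕ) :
    ∫ x, symmDirichletDensity c x * baryCoord x i ^ (k + 1) =
      c i / (∑ j, c j) *
        ∫ x, symmDirichletDensity (c + Pi.single i 1) x * baryCoord x i ^ k := by
  rw [← integral_const_mul]
  refine integral_congr_ae (ae_of_all _ fun x => ?_)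
  simp only
  rw [pow_succ', ← mul_assoc, symmDirichletDensity_mul_baryCoord fun i => by linarith [hc i]]
  ring

theorem integrable_mul_comp_baryCoord {d : ℕ} {c : Fin (d + 1) → ℝ} (hc : ∀ i, 1 < c i)
    (i : Fin (d + 1)) {f : ℝ → ℝ} (hf : Continuous f) :
    Integrable fun x => symmDirichletDensity c x * f (baryCoord x i) := by
  obtain ⟨C, hC⟩ := isCompact_Icc.exists_bound_of_continuousOn (s := Set.Icc (0 : ℝ) 1)
    hf.continuousOn
  refine ((integrable_symmDirichletDensity hc).mul_const C).mono'
    (by have := hf.measurable; fun_prop) (ae_of_all _ fun x => ?_)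
  have hp := symmDirichletDensity_nonneg (fun i => by linarith [hc i]) x
  by_cases hx : x ∈ simplex d
  · rw [norm_mul, Real.norm_of_nonneg hp]
    exact mul_le_mul_of_nonneg_left (hC _ ⟨baryCoord_nonneg hx i, baryCoord_le_one hx i⟩) hp
  · simp [symmDirichletDensity, hx]

theorem integrable_mul_baryCoord_pow {d : ℕ} {c : Fin (d + 1) → ℝ} (hc : ∀ i, 1 < c i)
    (i : Fin (d + 1)) (k : ℕ) :
    Integrable fun x => symmDirichletDensity c x * baryCoord x i ^ k :=
  integrable_mul_comp_baryCoord hc i (continuous_pow k)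

theorem integral_mul_baryCoord_pow {d : ℕ} {c : Fin (d + 1) → ℝ} (hc : ∀ i, 1 < c i)
    (i : Fin (d + 1)) {A : ℝ} (hA : ∑ j, c j = A) :
    ∫ x, symmDirichletDensity c x * baryCoord x i = c i / A ∧
    ∫ x, symmDirichletDensity c x * baryCoord x i ^ 2 = c i / A * ((c i + 1) / (A + 1)) ∧
    ∫ x, symmDirichletDensity c x * baryCoord x i ^ 3 =
      c i / A * ((c i + 1) / (A + 1) * ((c i + 2) / (A + 2))) := by
  have m0 : ∀ c : Fin (d + 1) → ℝ, (∀ i, 1 < c i) →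
      ∫ x, symmDirichletDensity c x * baryCoord x i ^ 0 = 1 := fun c hc => by
    simpa using integral_symmDirichletDensity hc
  have h1 := one_lt_add_single hc i
  have h2 := one_lt_add_single h1 i
  have h3 := one_lt_add_single h2 i
  have s1 : ∑ j, (c + Pi.single i 1 : Fin (d + 1) → ℝ) j = A + 1 := by
    simp [Finset.sum_add_distrib, hA]
  have s2 : ∑ j, (c + Pi.single i 1 + Pi.single i 1 : Fin (d + 1) → ℝ) j = A + 2 := by
    simp only [Pi.add_apply (c + Pi.single i 1), Finset.sum_add_distrib, s1]
    simp; ring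
  have c1 : (c + Pi.single i 1 : Fin (d + 1) → ℝ) i = c i + 1 := by simp
  have c2 : (c + Pi.single i 1 + Pi.single i 1 : Fin (d + 1) → ℝ) i = c i + 2 := by simp; ring
  have e1 := integral_mul_baryCoord_pow_succ hc i 0
  refine ⟨?_, ?_, ?_⟩
  · simp only [zero_add, pow_one] at e1
    rw [e1, m0 _ h1, hA, mul_one]
  · rw [integral_mul_baryCoord_pow_succ hc, integral_mul_baryCoord_pow_succ h1, m0 _ h2, s1, c1, hA,
      mul_one]
  · rw [integral_mul_baryCoord_pow_succ hc, integral_mul_baryCoord_pow_succ h1,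
      integral_mul_baryCoord_pow_succ h2, m0 _ h3, s1, s2, c1, c2, hA, mul_one]

/-- Moments of the relative deviation `wᵢ / rᵢ - 1` of a barycentric coordinate from its mean, for
the Dirichlet distribution with total mass `A` and mean `r`. -/
theorem integral_mul_relDev_pow {d : ℕ} {r : Fin (d + 1) → ℝ} {A : ℝ} (hr : ∀ i, 0 < r i)
    (hr1 : ∑ i, r i = 1) (hA : 0 < A) (hc : ∀ i, 1 < A * r i) (i : Fin (d + 1)) :
    ∫ x, symmDirichletDensity (fun j => A * r j) x * (baryCoord x i / r i - 1) = 0 ∧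
    ∫ x, symmDirichletDensity (fun j => A * r j) x * (baryCoord x i / r i - 1) ^ 2 =
      (1 - r i) / (r i * (A + 1)) ∧
    ∫ x, symmDirichletDensity (fun j => A * r j) x * (baryCoord x i / r i - 1) ^ 3 =
      2 * (1 - r i) * (1 - 2 * r i) / (r i ^ 2 * (A + 1) * (A + 2)) := by
  obtain ⟨m1, m2, m3⟩ := integral_mul_baryCoord_pow hc i (A := A)
    (by rw [← Finset.mul_sum, hr1, mul_one])
  have i0 := integrable_symmDirichletDensity hc
  have i1 : Integrable fun x => symmDirichletDensity (fun j => A * r j) x * baryCoord x i := by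
    simpa using integrable_mul_baryCoord_pow hc i 1
  have i2 := integrable_mul_baryCoord_pow hc i 2
  have i3 := integrable_mul_baryCoord_pow hc i 3
  have m0 := integral_symmDirichletDensity hc
  have hri := (hr i).ne'
  have comb : ∀ a₀ a₁ a₂ a₃ : ℝ, ∫ x, symmDirichletDensity (fun j => A * r j) x *
      (a₀ + a₁ * baryCoord x i + a₂ * baryCoord x i ^ 2 + a₃ * baryCoord x i ^ 3) =
      a₀ + a₁ * (A * r i / A) + a₂ * (A * r i / A * ((A * r i + 1) / (A + 1))) +
      a₃ * (A * r i / A * ((A * r i + 1) / (A + 1) * ((A * r i + 2) / (A + 2)))) := by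
    intro a₀ a₁ a₂ a₃
    have j0 := i0.const_mul a₀
    have j1 := i1.const_mul a₁
    have j2 := i2.const_mul a₂
    have j3 := i3.const_mul a₃
    have e0 : a₀ = ∫ x, a₀ * symmDirichletDensity (fun j => A * r j) x := by
      rw [integral_const_mul, m0, mul_one]
    rw [← m3, ← m2, ← m1]
    conv_rhs => rw [e0]
    simp only [← integral_const_mul]
    rw [← integral_add' j0 j1, ← integral_add' (j0.add j1) j2,
      ← integral_add' ((j0.add j1).add j2) j3]
    refine integral_congr_ae (ae_of_all _ fun x => ?_)
    simp only [Pi.add_apply]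
    ring
  refine ⟨?_, ?_, ?_⟩
  · have := comb (-1) (1 / r i) 0 0
    convert! this using 1
    · refine integral_congr_ae (ae_of_all _ fun x => ?_)
      simp only
      ring
    · field_simp
      ring
  · have := comb 1 (-2 / r i) (1 / r i ^ 2) 0
    convert! this using 1
    · refine integral_congr_ae (ae_of_all _ fun x => ?_)
      simp only
      ring
    · field_simp
      ring
  · have := comb (-1) (3 / r i) (-3 / r i ^ 2) (1 / r i ^ 3)
    convert! this using 1
    · refine integral_congr_ae (ae_of_all _ fun x => ?_)
      simp only
      ring
    · field_simp
      ring

/-! ### The density of the multivariate Gaussian distribution -/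

section GaussianDensity

variable {ι : Type*} [Fintype ι]

theorem integrable_exp_neg_norm_sq :
    Integrable fun x : EuclideanSpace ℝ ι => Real.exp (-‖x‖ ^ 2 / 2) := by
  have h := (GaussianFourier.integrable_cexp_neg_mul_sq_norm_add_of_euclideanSpace (b := 1 / 2)
    (by norm_num) 0 (0 : EuclideanSpace ℝ ι)).re
  refine h.congr (ae_of_all _ fun x => ?_)
  simp only [zero_mul, add_zero]
  rw [show -(1 / 2 : ℂ) * (‖x‖ : ℂ) ^ 2 = ((-‖x‖ ^ 2 / 2 : ℝ) : ℂ) by push_cast; ring,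
    ← Complex.ofReal_exp]
  rfl

/-- The standard Gaussian has the usual density, by comparison of characteristic functions. -/
theorem stdGaussian_eq_withDensity :
    stdGaussian (EuclideanSpace ℝ ι) = volume.withDensity fun x =>
      ENNReal.ofReal ((√(2 * Real.pi))⁻¹ ^ Fintype.card ι * Real.exp (-‖x‖ ^ 2 / 2)) := by
  have hi := (integrable_exp_neg_norm_sq (ι := ι)).const_mul ((√(2 * Real.pi))⁻¹ ^ Fintype.card ι)
  have hfin : IsFiniteMeasure ((volume : Measure (EuclideanSpace ℝ ι)).withDensity fun x =>
      ENNReal.ofReal ((√(2 * Real.pi))⁻¹ ^ Fintype.card ι * Real.exp (-‖x‖ ^ 2 / 2))) :=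
    isFiniteMeasure_withDensity_ofReal hi.2
  apply Measure.ext_of_charFun (E := EuclideanSpace ℝ ι)
  ext t
  rw [charFun_stdGaussian, charFun_apply, integral_withDensity_eq_integral_toReal_smul (by fun_prop)
    (ae_of_all _ fun x => ENNReal.ofReal_lt_top)]
  have h := GaussianFourier.integral_cexp_neg_mul_sq_norm_add_of_euclideanSpace (b := 1 / 2)
    (by norm_num) Complex.I t
  have e : ∀ x : EuclideanSpace ℝ ι,
      (ENNReal.ofReal ((√(2 * Real.pi))⁻¹ ^ Fintype.card ι * Real.exp (-‖x‖ ^ 2 / 2))).toReal •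
        Complex.exp (inner ℝ x t * Complex.I) =
      ((√(2 * Real.pi) : ℂ)⁻¹ ^ Fintype.card ι) *
        Complex.exp (-(1 / 2 : ℂ) * ‖x‖ ^ 2 + Complex.I * inner ℝ t x) := by
    intro x
    rw [ENNReal.toReal_ofReal (by positivity), Complex.exp_add, Complex.real_smul,
      real_inner_comm t x]
    push_cast
    rw [mul_assoc]
    congr 3
    · ring
    · ring
  simp_rw [e]
  rw [integral_const_mul, h, ← mul_assoc]
  have h2 : ((√(2 * Real.pi) : ℂ)⁻¹ ^ Fintype.card ι) *
      (Real.pi / (1 / 2 : ℂ)) ^ (Fintype.card ι / 2 : ℂ) = 1 := by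
    have h3 : (Real.pi / (1 / 2 : ℂ)) = ((√(2 * Real.pi) ^ 2 : ℝ) : ℂ) := by
      rw [Real.sq_sqrt (by positivity)]; push_cast; ring
    have h4 : ((√(2 * Real.pi) ^ 2 : ℝ) : ℂ) ^ (Fintype.card ι / 2 : ℂ) =
        (√(2 * Real.pi) : ℂ) ^ Fintype.card ι := by
      rw [show (Fintype.card ι / 2 : ℂ) = ((Fintype.card ι / 2 : ℝ) : ℂ) by push_cast; rfl,
        ← Complex.ofReal_cpow (by positivity), ← Real.rpow_natCast (√(2 * Real.pi)) 2,
        ← Real.rpow_mul (by positivity), ← Complex.ofReal_pow, ← Real.rpow_natCast]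
      congr 2
      push_cast; ring
    rw [h3, h4, ← mul_pow, inv_mul_cancel₀, one_pow]
    exact_mod_cast (Real.sqrt_pos.2 (by positivity : 0 < 2 * Real.pi)).ne'
  rw [h2, one_mul, Complex.I_sq]
  congr 1
  ring

variable [DecidableEq ι]

open Matrix

/-- The density of the Gaussian distribution with mean `m` and covariance matrix `S`. -/
noncomputable def gaussianDensity (m : EuclideanSpace ℝ ι) (S : Matrix ι ι ℝ)
    (x : EuclideanSpace ℝ ι) : ℝ :=
  (√(2 * Real.pi))⁻¹ ^ Fintype.card ι * (√S.det)⁻¹ *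
    Real.exp (-((x - m).ofLp ⬝ᵥ S⁻¹ *ᵥ (x - m).ofLp) / 2)

theorem gaussianDensity_nonneg (m : EuclideanSpace ℝ ι) (S : Matrix ι ι ℝ)
    (x : EuclideanSpace ℝ ι) : 0 ≤ gaussianDensity m S x := by
  unfold gaussianDensity; positivity

@[fun_prop]
theorem measurable_gaussianDensity (m : EuclideanSpace ℝ ι) (S : Matrix ι ι ℝ) :
    Measurable (gaussianDensity m S) := by
  unfold gaussianDensity
  simp only [dotProduct, mulVec]
  fun_prop

open scoped MatrixOrder in
theorem multivariateGaussian_eq_withDensity (m : EuclideanSpace ℝ ι) {S : Matrix ι ι ℝ}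
    (hS : S.PosDef) : multivariateGaussian m S =
      volume.withDensity fun x => ENNReal.ofReal (gaussianDensity m S x) := by
  set R := CFC.sqrt S with hR
  have hRR : R * R = S := CFC.sqrt_mul_sqrt_self _ hS.posSemidef.nonneg
  have hRpos : R.PosSemidef := (CFC.sqrt_nonneg S).posSemidef
  have hdet2 : R.det * R.det = S.det := by rw [← det_mul, hRR]
  have hdet0 : R.det ≠ 0 := fun h => by
    have := hS.det_pos
    rw [← hdet2, h, mul_zero] at this
    exact this.false
  have hdet : 0 < R.det := lt_of_le_of_ne hRpos.det_nonneg hdet0.symm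
  have hsqrt : √S.det = R.det := by rw [← hdet2, Real.sqrt_mul_self hdet.le]
  have hunit : IsUnit R.det := isUnit_iff_ne_zero.2 hdet0
  set L := toEuclideanCLM (n := ι) (𝕜 := ℝ) R with hL
  have hLdet : LinearMap.det (L : EuclideanSpace ℝ ι →ₗ[ℝ] EuclideanSpace ℝ ι) = R.det := by
    rw [hL, coe_toEuclideanCLM_eq_toEuclideanLin]
    exact LinearMap.det_toLpLin 2 R
  have hvol : Measure.map L volume =
      ENNReal.ofReal R.det⁻¹ • (volume : Measure (EuclideanSpace ℝ ι)) := by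
    have := Measure.map_linearMap_addHaar_eq_smul_addHaar
      (volume : Measure (EuclideanSpace ℝ ι)) (f := (L : EuclideanSpace ℝ ι →ₗ[ℝ] _))
      (by rw [hLdet]; exact hdet0)
    rw [hLdet, abs_of_pos (inv_pos.2 hdet)] at this
    exact this
  -- substituting `x = m + R z` turns the quadratic form of `S⁻¹ = R⁻¹ R⁻¹` into `‖z‖²`
  have hquad : ∀ z : EuclideanSpace ℝ ι,
      (L z).ofLp ⬝ᵥ S⁻¹ *ᵥ (L z).ofLp = ‖z‖ ^ 2 := by
    intro z
    have hRT : Rᵀ = R := by simpa [Matrix.IsSymm] using hRpos.1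
    have e : S⁻¹ * R = R⁻¹ := by
      rw [← hRR, Matrix.mul_inv_rev, mul_assoc, nonsing_inv_mul _ hunit, mul_one]
    have e2 : R *ᵥ z.ofLp = z.ofLp ᵥ* R := by rw [← vecMul_transpose, hRT]
    rw [hL, ofLp_toEuclideanCLM, mulVec_mulVec, e, e2, dotProduct_mulVec, vecMul_vecMul,
      mul_nonsing_inv _ hunit, vecMul_one, EuclideanSpace.real_norm_sq_eq, dotProduct]
    exact Finset.sum_congr rfl fun i _ => (sq _).symm
  ext A hA
  rw [multivariateGaussian, Measure.map_apply (by fun_prop) hA, stdGaussian_eq_withDensity,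
    withDensity_apply _ (by measurability), withDensity_apply _ hA,
    ← lintegral_indicator hA, ← lintegral_indicator (by measurability)]
  set F : EuclideanSpace ℝ ι → ℝ≥0∞ := fun y =>
    A.indicator (fun x => ENNReal.ofReal (gaussianDensity m S x)) (m + y) with hF
  have hFm : Measurable F := by
    have : Measurable (A.indicator (fun x => ENNReal.ofReal (gaussianDensity m S x))) :=
      Measurable.indicator (by fun_prop) hA
    exact this.comp (measurable_const_add m)
  have htrans : ∫⁻ x, A.indicator (fun x => ENNReal.ofReal (gaussianDensity m S x)) x = ∫⁻ y, F y :=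
    (lintegral_add_left_eq_self _ m).symm
  have hcomp : ∫⁻ y, F y = ENNReal.ofReal R.det * ∫⁻ z, F (L z) := by
    rw [← lintegral_map hFm L.measurable, hvol, lintegral_smul_measure, smul_eq_mul, ← mul_assoc,
      ← ENNReal.ofReal_mul hdet.le, mul_inv_cancel₀ hdet0, ENNReal.ofReal_one, one_mul]
  rw [htrans, hcomp, ← lintegral_const_mul _ (by fun_prop)]
  refine lintegral_congr fun z => ?_
  by_cases hz : m + L z ∈ A
  · rw [hF]
    simp only
    rw [Set.indicator_of_mem hz, Set.indicator_of_mem (by exact hz),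
      ← ENNReal.ofReal_mul hdet.le, gaussianDensity, add_sub_cancel_left, hquad, hsqrt]
    congr 1
    field_simp
  · rw [hF]
    simp only
    rw [Set.indicator_of_notMem hz, Set.indicator_of_notMem (by exact hz), mul_zero]

theorem integrable_gaussianDensity (m : EuclideanSpace ℝ ι) {S : Matrix ι ι ℝ}
    (hS : S.PosDef) : Integrable (gaussianDensity m S) ∧ ∫ x, gaussianDensity m S x = 1 := by
  have h1 : ∫⁻ x, ENNReal.ofReal (gaussianDensity m S x) = 1 := by
    have : (multivariateGaussian m S) Set.univ = 1 := measure_univ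
    rwa [multivariateGaussian_eq_withDensity m hS, withDensity_apply _ MeasurableSet.univ,
      Measure.restrict_univ] at this
  have h0 := ae_of_all (volume : Measure (EuclideanSpace ℝ ι)) (gaussianDensity_nonneg m S)
  refine ⟨⟨(measurable_gaussianDensity m S).aestronglyMeasurable, ?_⟩, ?_⟩
  · rw [hasFiniteIntegral_iff_ofReal h0, h1]
    exact ENNReal.one_lt_top
  · rw [integral_eq_lintegral_of_nonneg_ae h0 (measurable_gaussianDensity m S).aestronglyMeasurable,
      h1, ENNReal.toReal_one]

end GaussianDensity

/-! ### The matrix `diag(r) - r rᵀ` -/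

section CovarianceMatrix

open Matrix

variable {d : ℕ} {r : Fin d → ℝ}

theorem sigmaMat_mulVec (r v : Fin d → ℝ) (i : Fin d) :
    (sigmaMat r *ᵥ v) i = r i * v i - r i * ∑ j, r j * v j := by
  simp [sigmaMat, sub_mulVec, mulVec_diagonal, vecMulVec_mulVec, dotProduct, mul_comm]

theorem det_sigmaMat (r : Fin d → ℝ) :
    (sigmaMat r).det = (1 - ∑ i, r i) * ∏ i, r i := by
  have e : sigmaMat r = diagonal r * 
      (1 + replicateCol Unit (fun _ => (-1 : ℝ)) * replicateRow Unit r) := by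
    ext i j
    rw [mul_add, mul_one, Matrix.add_apply, diagonal_mul, Matrix.mul_apply, sigmaMat,
      Matrix.sub_apply, vecMulVec_apply]
    simp
    ring
  rw [e, det_mul, det_diagonal, det_one_add_replicateCol_mul_replicateRow]
  simp [dotProduct]
  ring

theorem posDef_sigmaMat (hr : ∀ i, 0 < r i) (hr1 : ∑ i, r i < 1) : (sigmaMat r).PosDef := by
  refine .of_dotProduct_mulVec_pos ?_ fun v hv => ?_
  · ext i j
    simp [sigmaMat, vecMulVec_apply, diagonal_apply, conjTranspose_apply, eq_comm, mul_comm]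
    split_ifs with h
    · rw [h]
    · rfl
  · have h1 : star v ⬝ᵥ sigmaMat r *ᵥ v = ∑ i, r i * v i ^ 2 - (∑ i, r i * v i) ^ 2 := by
      simp only [dotProduct, sigmaMat_mulVec, star_trivial, mul_sub, Finset.sum_sub_distrib]
      congr 1
      · exact Finset.sum_congr rfl fun i _ => by ring
      · rw [sq, Finset.sum_mul]
        exact Finset.sum_congr rfl fun i _ => by ring
    have h2 : (∑ i, r i * v i) ^ 2 ≤ (∑ i, r i) * ∑ i, r i * v i ^ 2 :=
      Finset.sum_sq_le_sum_mul_sum_of_sq_le_mul _ (fun i _ => (hr i).le)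
        (fun i _ => mul_nonneg (hr i).le (sq_nonneg _)) (fun i _ => le_of_eq (by ring))
    have h3 : 0 < ∑ i, r i * v i ^ 2 := by
      obtain ⟨i, hi⟩ := Function.ne_iff.1 hv
      refine Finset.sum_pos' (fun i _ => mul_nonneg (hr i).le (sq_nonneg _))
        ⟨i, Finset.mem_univ i, mul_pos (hr i) (sq_pos_of_ne_zero hi)⟩
    rw [h1]
    nlinarith

/-- The inverse of `s • (diag(r) - r rᵀ)` is the quadratic form `s⁻¹ ∑ δᵢ² / rᵢ` in the barycentric
deviations, whose last term `δ_{d+1} = -∑ δᵢ` is weighted with `r_{d+1} = 1 - ∑ rᵢ`. -/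
theorem dotProduct_inv_smul_sigmaMat (hr : ∀ i, 0 < r i) (hr1 : ∑ i, r i < 1) {s : ℝ} (hs : 0 < s)
    (z : Fin d → ℝ) :
    z ⬝ᵥ (s • sigmaMat r)⁻¹ *ᵥ z =
      s⁻¹ * (∑ i, z i ^ 2 / r i + (∑ i, z i) ^ 2 / (1 - ∑ i, r i)) := by
  -- the preimage of `z` under the matrix
  set w : Fin d → ℝ := fun i => s⁻¹ * (z i / r i + (∑ j, z j) / (1 - ∑ j, r j)) with hw
  have h0 : 0 < 1 - ∑ i, r i := by linarith
  have h1 : (s • sigmaMat r) *ᵥ w = z := by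
    ext i
    rw [smul_mulVec, Pi.smul_apply, sigmaMat_mulVec, smul_eq_mul]
    have : ∑ j, r j * w j = s⁻¹ * ((∑ j, z j) / (1 - ∑ j, r j)) := by
      have e : ∀ j, r j * w j = s⁻¹ * (z j + r j * ((∑ j, z j) / (1 - ∑ j, r j))) := fun j => by
        have := (hr j).ne'
        rw [hw]; field_simp
      simp_rw [e]
      rw [← Finset.mul_sum, Finset.sum_add_distrib, ← Finset.sum_mul]
      field_simp
      ring
    rw [this, hw]
    have := (hr i).ne'
    field_simp
    ring
  have hP : (s • sigmaMat r).PosDef := (posDef_sigmaMat hr hr1).smul hs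
  have h2 : (s • sigmaMat r)⁻¹ *ᵥ z = w := by
    rw [show (s • sigmaMat r)⁻¹ *ᵥ z = (s • sigmaMat r)⁻¹ *ᵥ ((s • sigmaMat r) *ᵥ w) by rw [h1],
      mulVec_mulVec, nonsing_inv_mul _ (isUnit_iff_ne_zero.2 hP.det_pos.ne'), one_mulVec]
  rw [h2, dotProduct, hw]
  have e : ∀ i, z i * (s⁻¹ * (z i / r i + (∑ j, z j) / (1 - ∑ j, r j))) =
      s⁻¹ * (z i ^ 2 / r i) + z i * (s⁻¹ * ((∑ j, z j) / (1 - ∑ j, r j))) := fun i => by ring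
  simp_rw [e]
  rw [Finset.sum_add_distrib, ← Finset.mul_sum, ← Finset.sum_mul]
  ring

end CovarianceMatrix

/-! ### Comparison of the two densities -/

theorem log_one_add_le_cubic {u : ℝ} (hu : -1 < u) :
    Real.log (1 + u) ≤ u - u ^ 2 / 2 + u ^ 3 / 3 := by
  -- the difference has derivative `v ^ 3 / (1 + v)`, hence its minimum at `0`
  set f : ℝ → ℝ := fun u => u - u ^ 2 / 2 + u ^ 3 / 3 - Real.log (1 + u) with hf
  have hd : ∀ v : ℝ, -1 < v → HasDerivAt f (v ^ 3 / (1 + v)) v := by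
    intro v hv
    have hv' : 1 + v ≠ 0 := by linarith
    have h := ((((hasDerivAt_id v).sub (((hasDerivAt_id v).pow 2).div_const 2)).add
      (((hasDerivAt_id v).pow 3).div_const 3)).sub (((hasDerivAt_id v).const_add 1).log hv'))
    convert! h using 1
    simp only [id]
    field_simp
    ring
  suffices 0 ≤ f u by simp only [hf] at this; linarith
  have f0 : f 0 = 0 := by simp [hf]
  rcases le_total 0 u with h | h
  · have : MonotoneOn f (Set.Ici 0) := by
      refine monotoneOn_of_deriv_nonneg (convex_Ici 0)
        (fun v hv => (hd v (by simp at hv; linarith)).continuousAt.continuousWithinAt) ?_ ?_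
      · intro v hv
        rw [interior_Ici, Set.mem_Ioi] at hv
        exact (hd v (by linarith)).differentiableAt.differentiableWithinAt
      · intro v hv
        rw [interior_Ici, Set.mem_Ioi] at hv
        rw [(hd v (by linarith)).deriv]
        positivity
    rw [← f0]
    exact this Set.self_mem_Ici h h
  · have : AntitoneOn f (Set.Ioc (-1) 0) := by
      refine antitoneOn_of_deriv_nonpos (convex_Ioc (-1) 0)
        (fun v hv => (hd v hv.1).continuousAt.continuousWithinAt) ?_ ?_
      · intro v hv
        rw [interior_Ioc] at hv
        exact (hd v hv.1).differentiableAt.differentiableWithinAt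
      · intro v hv
        rw [interior_Ioc] at hv
        rw [(hd v hv.1).deriv]
        exact div_nonpos_of_nonpos_of_nonneg (Odd.pow_nonpos (by decide) hv.2.le)
          (by linarith [hv.1])
    rw [← f0]
    exact this ⟨hu, h⟩ ⟨by norm_num, le_rfl⟩ h

section Comparison

variable {d : ℕ} {r : Fin (d + 1) → ℝ} {A : ℝ}

/-- The logarithm of the ratio of the Dirichlet density to the Gaussian density at the common mean
`r`, for the Dirichlet distribution of total mass `A`. -/
noncomputable def logRatioConst (r : Fin (d + 1) → ℝ) (A : ℝ) : ℝ :=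
  Real.log (Real.Gamma A) - ∑ i, Real.log (Real.Gamma (A * r i)) +
    ∑ i, (A * r i - 1) * Real.log (r i) + d / 2 * Real.log (2 * Real.pi) +
    1 / 2 * ∑ i, Real.log (r i) - d / 2 * Real.log (1 + A)

/-- The part of the upper bound on the log density ratio that depends on one relative deviation
`u = wᵢ / rᵢ - 1`: the cubic Taylor bound for the logarithm, plus the Gaussian exponent. -/
noncomputable def logRatioTerm (ρ A u : ℝ) : ℝ :=
  (A * ρ - 1) * (u - u ^ 2 / 2 + u ^ 3 / 3) + (1 + A) / 2 * (ρ * u ^ 2)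

/-- By Stirling's formula the two densities have the same height at the mean up to `O(1 / A)`. The
negative term `-d / (2 (1 + A))` comes from the covariance normalisation `1 + A` instead of `A`; it
cancels against the quadratic terms in `integral_mul_logRatio_le`. -/
theorem logRatioConst_le (hr : ∀ i, 0 < r i) (hr1 : ∑ i, r i = 1) (hA : 0 < A) :
    logRatioConst r A ≤ 1 / (12 * A) - d / (2 * (1 + A)) := by
  have h1 := stirlingRemainder_le hA
  have h2 : ∑ i : Fin (d + 1), Real.log (2 * Real.pi) / 2 ≤ ∑ i, stirlingRemainder (A * r i) :=
    Finset.sum_le_sum fun i _ => le_stirlingRemainder (mul_pos hA (hr i))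
  have h3 : ∑ i, stirlingRemainder (A * r i) = ∑ i, Real.log (Real.Gamma (A * r i)) -
      (A * Real.log A + ∑ i, A * r i * Real.log (r i) - (d + 1) / 2 * Real.log A
        - 1 / 2 * ∑ i, Real.log (r i)) + A := by
    have e : ∀ i, stirlingRemainder (A * r i) = Real.log (Real.Gamma (A * r i)) -
        (r i * (A * Real.log A) + A * r i * Real.log (r i) - 1 / 2 * Real.log A -
          1 / 2 * Real.log (r i)) + r i * A := by
      intro i
      rw [stirlingRemainder, Real.log_mul hA.ne' (hr i).ne']
      ring
    simp_rw [e]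
    simp only [Finset.sum_add_distrib, Finset.sum_sub_distrib, ← Finset.sum_mul,
      ← Finset.mul_sum, hr1, Finset.sum_const, Finset.card_univ, Fintype.card_fin, nsmul_eq_mul]
    push_cast
    ring
  have h4 : Real.log A - Real.log (1 + A) ≤ -(1 / (1 + A)) := by
    rw [← Real.log_div hA.ne' (by positivity)]
    refine (Real.log_le_sub_one_of_pos (by positivity)).trans (le_of_eq ?_)
    field_simp
    ring
  rw [stirlingRemainder] at h1
  rw [h3] at h2
  simp only [Finset.sum_const, Finset.card_univ, Fintype.card_fin, nsmul_eq_mul] at h2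
  push_cast at h2
  have e5 : ∑ i, (A * r i - 1) * Real.log (r i) =
      ∑ i, A * r i * Real.log (r i) - ∑ i, Real.log (r i) := by
    rw [← Finset.sum_sub_distrib]
    exact Finset.sum_congr rfl fun i _ => by ring
  have h5 : (d : ℝ) / 2 * (Real.log A - Real.log (1 + A)) ≤ d / 2 * (-(1 / (1 + A))) := by
    gcongr
  have e6 : (d : ℝ) / (2 * (1 + A)) = d / 2 * (1 / (1 + A)) := by field_simp
  rw [logRatioConst, e5, e6]
  linarith

theorem gaussianDensity_eq_exp (hr : ∀ i, 0 < r i) (hr1 : ∑ i, r i = 1) (hA : 0 < A)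
    (x : EuclideanSpace ℝ (Fin d)) :
    gaussianDensity (WithLp.toLp 2 fun i => r i.castSucc)
      ((1 + A)⁻¹ • sigmaMat fun i => r i.castSucc) x =
    Real.exp (-(d / 2 * Real.log (2 * Real.pi)) - 1 / 2 * ∑ i, Real.log (r i) +
      d / 2 * Real.log (1 + A) -
      (1 + A) / 2 * ∑ i, r i * (baryCoord x i / r i - 1) ^ 2) := by
  have hlast : 1 - ∑ i : Fin d, r i.castSucc = r (Fin.last d) := by
    rw [← hr1, Fin.sum_univ_castSucc]; ring
  have hlt : ∑ i : Fin d, r i.castSucc < 1 := by linarith [hr (Fin.last d)]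
  have hA1 : 0 < 1 + A := by linarith
  have hdet : ((1 + A)⁻¹ • sigmaMat fun i => r i.castSucc).det = (1 + A)⁻¹ ^ d * ∏ i, r i := by
    rw [Matrix.det_smul, det_sigmaMat, hlast, Fintype.card_fin, Fin.prod_univ_castSucc]
    ring
  have hprod : 0 < ∏ i, r i := Finset.prod_pos fun i _ => hr i
  have hsqrt : ∀ y : ℝ, 0 < y → (√y)⁻¹ = Real.exp (-(1 / 2 * Real.log y)) := by
    intro y hy
    rw [Real.exp_neg, Real.sqrt_eq_rpow, Real.rpow_def_of_pos hy, mul_comm]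
  have hquad : ((x - WithLp.toLp 2 fun i : Fin d => r i.castSucc).ofLp ⬝ᵥ
      ((1 + A)⁻¹ • sigmaMat fun i => r i.castSucc)⁻¹.mulVec
        (x - WithLp.toLp 2 fun i : Fin d => r i.castSucc).ofLp) =
      (1 + A) * ∑ i, r i * (baryCoord x i / r i - 1) ^ 2 := by
    rw [dotProduct_inv_smul_sigmaMat (fun i => hr _) hlt (inv_pos.2 hA1), inv_inv, hlast,
      Fin.sum_univ_castSucc]
    congr 2
    · refine Finset.sum_congr rfl fun i _ => ?_
      have := (hr i.castSucc).ne'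
      simp only [baryCoord, Fin.snoc_castSucc, WithLp.ofLp_sub, Pi.sub_apply]
      field_simp
    · have h0 := (hr (Fin.last d)).ne'
      simp only [baryCoord, Fin.snoc_last, WithLp.ofLp_sub, Pi.sub_apply, Finset.sum_sub_distrib]
      rw [show ∑ i : Fin d, r i.castSucc = 1 - r (Fin.last d) by linarith]
      field_simp
      ring
  rw [gaussianDensity, hquad, hdet, hsqrt _ (by positivity), hsqrt _ (by positivity),
    Fintype.card_fin, ← Real.exp_nat_mul, ← Real.exp_add, ← Real.exp_add,
    Real.log_mul (by positivity) hprod.ne', Real.log_pow, Real.log_inv,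
    Real.log_prod fun i _ => (hr i).ne']
  congr 1
  ring

/-- The odd-degree Taylor polynomial bounds the logarithm from above on the whole simplex, so no
localisation near the mean is needed. -/
theorem symmDirichletDensity_le (hr : ∀ i, 0 < r i) (hr1 : ∑ i, r i = 1) (hA : 0 < A)
    (hc : ∀ i, 1 < A * r i) (x : EuclideanSpace ℝ (Fin d)) :
    symmDirichletDensity (fun i => A * r i) x ≤
      gaussianDensity (WithLp.toLp 2 fun i => r i.castSucc)
        ((1 + A)⁻¹ • sigmaMat fun i => r i.castSucc) x *
      Real.exp (logRatioConst r A + ∑ i, logRatioTerm (r i) A (baryCoord x i / r i - 1)) := by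
  have hnn : 0 ≤ gaussianDensity (WithLp.toLp 2 fun i => r i.castSucc)
        ((1 + A)⁻¹ • sigmaMat fun i => r i.castSucc) x *
      Real.exp (logRatioConst r A + ∑ i, logRatioTerm (r i) A (baryCoord x i / r i - 1)) :=
    mul_nonneg (gaussianDensity_nonneg _ _ _) (Real.exp_pos _).le
  by_cases hx : x ∈ simplex d
  swap
  · rwa [symmDirichletDensity, Set.indicator_of_notMem hx]
  -- on the boundary the density vanishes, because every exponent `A rᵢ - 1` is positive
  by_cases hw : ∀ i, 0 < baryCoord x i
  swap
  · push Not at hw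
    obtain ⟨i, hi⟩ := hw
    rwa [symmDirichletDensity, Set.indicator_of_mem hx,
      Finset.prod_eq_zero (f := fun i => baryCoord x i ^ (A * r i - 1)) (Finset.mem_univ i),
      mul_zero]
    rw [le_antisymm hi (baryCoord_nonneg hx i), Real.zero_rpow (by linarith [hc i])]
  rw [gaussianDensity_eq_exp hr hr1 hA, ← Real.exp_add, symmDirichletDensity,
    Set.indicator_of_mem hx, ← Finset.mul_sum, hr1, mul_one]
  have hG : ∀ i, 0 < Real.Gamma (A * r i) := fun i => Real.Gamma_pos_of_pos (mul_pos hA (hr i))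
  have hGA := Real.Gamma_pos_of_pos hA
  have hP : 0 < ∏ i, Real.Gamma (A * r i) := Finset.prod_pos fun i _ => hG i
  have hW : 0 < ∏ i, baryCoord x i ^ (A * r i - 1) :=
    Finset.prod_pos fun i _ => Real.rpow_pos_of_pos (hw i) _
  rw [← Real.log_le_iff_le_exp (by positivity), Real.log_mul (by positivity) hW.ne',
    Real.log_div hGA.ne' hP.ne', Real.log_prod fun i _ => (hG i).ne',
    Real.log_prod fun i _ => (Real.rpow_pos_of_pos (hw i) _).ne', logRatioConst]
  have key : ∑ i, Real.log (baryCoord x i ^ (A * r i - 1)) ≤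
      ∑ i, ((A * r i - 1) * Real.log (r i) + (logRatioTerm (r i) A (baryCoord x i / r i - 1) -
        (1 + A) / 2 * (r i * (baryCoord x i / r i - 1) ^ 2))) := by
    refine Finset.sum_le_sum fun i _ => ?_
    have hpos : 0 < baryCoord x i / r i := div_pos (hw i) (hr i)
    have h1 := log_one_add_le_cubic (u := baryCoord x i / r i - 1) (by linarith)
    rw [add_sub_cancel, Real.log_div (hw i).ne' (hr i).ne'] at h1
    have h2 := mul_le_mul_of_nonneg_left h1 (by linarith [hc i] : 0 ≤ A * r i - 1)
    rw [Real.log_rpow (hw i), logRatioTerm]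
    linarith
  rw [Finset.sum_add_distrib, Finset.sum_sub_distrib, ← Finset.mul_sum] at key
  linarith

theorem continuous_logRatioTerm (ρ A : ℝ) : Continuous (logRatioTerm ρ A) := by
  unfold logRatioTerm; fun_prop

/-- The expectations of the order-one quadratic terms combine to `(1 - rᵢ) / (2 (1 + A))` and an
error of order `1 / (A rᵢ)`; the cubic term only contributes to that error. -/
theorem integral_mul_logRatioTerm_le (hr : ∀ i, 0 < r i) (hr1 : ∑ i, r i = 1) (hA : 0 < A)
    (hc : ∀ i, 1 < A * r i) (i : Fin (d + 1)) :
    ∫ x, symmDirichletDensity (fun j => A * r j) x *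
        logRatioTerm (r i) A (baryCoord x i / r i - 1) ≤
      (1 - r i) / (2 * (1 + A)) + 7 / 6 * (1 / (A * r i)) := by
  obtain ⟨m1, m2, m3⟩ := integral_mul_relDev_pow hr hr1 hA hc i
  have hi : ∀ k : ℕ, Integrable fun x =>
      symmDirichletDensity (fun j => A * r j) x * (baryCoord x i / r i - 1) ^ k := fun k =>
    integrable_mul_comp_baryCoord hc i (f := fun w => (w / r i - 1) ^ k) (by fun_prop)
  have j1 : Integrable fun x =>
      symmDirichletDensity (fun j => A * r j) x * (baryCoord x i / r i - 1) := by simpa using hi 1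
  have e : ∫ x, symmDirichletDensity (fun j => A * r j) x *
        logRatioTerm (r i) A (baryCoord x i / r i - 1) =
      (A * r i - 1) * 0 +
      ((1 + A) / 2 * r i - (A * r i - 1) / 2) * ((1 - r i) / (r i * (A + 1))) +
      (A * r i - 1) / 3 * (2 * (1 - r i) * (1 - 2 * r i) / (r i ^ 2 * (A + 1) * (A + 2))) := by
    have k1 := j1.const_mul (A * r i - 1)
    have k2 := (hi 2).const_mul ((1 + A) / 2 * r i - (A * r i - 1) / 2)
    have k3 := (hi 3).const_mul ((A * r i - 1) / 3)
    rw [← m3, ← m2, ← m1]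
    simp only [← integral_const_mul]
    rw [← integral_add' k1 k2, ← integral_add' (k1.add k2) k3]
    refine integral_congr_ae (ae_of_all _ fun x => ?_)
    simp only [Pi.add_apply, logRatioTerm]
    ring
  have hri := hr i
  have hle1 : r i ≤ 1 := hr1 ▸ Finset.single_le_sum (fun j _ => (hr j).le) (Finset.mem_univ i)
  have t2 : ((1 + A) / 2 * r i - (A * r i - 1) / 2) * ((1 - r i) / (r i * (A + 1))) ≤
      (1 - r i) / (2 * (1 + A)) + 1 / 2 * (1 / (A * r i)) := by
    have e2 : ((1 + A) / 2 * r i - (A * r i - 1) / 2) * ((1 - r i) / (r i * (A + 1))) =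
      (1 - r i) / (2 * (1 + A)) + 1 / 2 * ((1 - r i) / ((A + 1) * r i)) := by
      field_simp; ring
    rw [e2]
    gcongr <;> linarith
  have t3 : (A * r i - 1) / 3 * (2 * (1 - r i) * (1 - 2 * r i) / (r i ^ 2 * (A + 1) * (A + 2))) ≤
      2 / 3 * (1 / (A * r i)) := by
    have hq : (1 - r i) * (1 - 2 * r i) ≤ 1 := by nlinarith
    calc (A * r i - 1) / 3 * (2 * (1 - r i) * (1 - 2 * r i) / (r i ^ 2 * (A + 1) * (A + 2)))
        = (A * r i - 1) * ((1 - r i) * (1 - 2 * r i)) *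
            (2 / 3 / (r i ^ 2 * (A + 1) * (A + 2))) := by ring
      _ ≤ (A * r i) * (2 / 3 / (r i ^ 2 * A * A)) := by
        have h1 : (A * r i - 1) * ((1 - r i) * (1 - 2 * r i)) ≤ A * r i := by
          have := mul_le_mul_of_nonneg_left hq (by linarith [hc i] : 0 ≤ A * r i - 1)
          linarith
        have h2 : 2 / 3 / (r i ^ 2 * (A + 1) * (A + 2)) ≤ 2 / 3 / (r i ^ 2 * A * A) := by
          gcongr <;> linarith
        exact (mul_le_mul_of_nonneg_right h1 (by positivity)).trans
          (mul_le_mul_of_nonneg_left h2 (by positivity))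
      _ = 2 / 3 * (1 / (A * r i)) := by field_simp
  rw [e]
  linarith

/-- The bound on the relative entropy of the Dirichlet distribution with respect to its Gaussian
approximation. -/
theorem integral_mul_logRatio_le (hr : ∀ i, 0 < r i) (hr1 : ∑ i, r i = 1) (hA : 0 < A)
    (hc : ∀ i, 1 < A * r i) :
    Integrable (fun x => symmDirichletDensity (fun j => A * r j) x *
      (logRatioConst r A + ∑ i, logRatioTerm (r i) A (baryCoord x i / r i - 1))) ∧
    ∫ x, symmDirichletDensity (fun j => A * r j) x *
      (logRatioConst r A + ∑ i, logRatioTerm (r i) A (baryCoord x i / r i - 1)) ≤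
      5 / 4 * ∑ i, 1 / (A * r i) := by
  have hi : ∀ i, Integrable fun x => symmDirichletDensity (fun j => A * r j) x *
      logRatioTerm (r i) A (baryCoord x i / r i - 1) := fun i =>
    integrable_mul_comp_baryCoord hc i (f := fun w => logRatioTerm (r i) A (w / r i - 1))
      ((continuous_logRatioTerm _ _).comp (by fun_prop))
  have h0 := (integrable_symmDirichletDensity hc).mul_const (logRatioConst r A)
  have hs := integrable_finsetSum Finset.univ fun i _ => hi i
  simp only [mul_add, Finset.mul_sum]
  refine ⟨h0.add hs, ?_⟩
  rw [integral_add h0 hs, integral_mul_const, integral_symmDirichletDensity hc, one_mul,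
    integral_finsetSum _ fun i _ => hi i]
  have h1 := Finset.sum_le_sum fun i (_ : i ∈ Finset.univ) =>
    integral_mul_logRatioTerm_le hr hr1 hA hc i
  rw [Finset.sum_add_distrib, ← Finset.mul_sum, ← Finset.sum_div, Finset.sum_sub_distrib, hr1] at h1
  simp only [Finset.sum_const, Finset.card_univ, Fintype.card_fin, nsmul_eq_mul] at h1
  push_cast at h1
  have h2 := logRatioConst_le hr hr1 hA
  have h3 : 1 / A ≤ ∑ i, 1 / (A * r i) := by
    refine le_trans ?_ (Finset.single_le_sum (f := fun i => 1 / (A * r i))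
      (fun j _ => (one_div_pos.2 (mul_pos hA (hr j))).le) (Finset.mem_univ (Fin.last d)))
    have := hr (Fin.last d)
    have hle1 : r (Fin.last d) ≤ 1 :=
      hr1 ▸ Finset.single_le_sum (fun j _ => (hr j).le) (Finset.mem_univ _)
    gcongr
    exact mul_le_of_le_one_right hA.le hle1
  have e1 : 1 / (12 * A) = 1 / 12 * (1 / A) := by field_simp
  have e2 : ((d : ℝ) + 1) * 1 - 1 = d := by ring
  rw [e1] at h2
  rw [e2] at h1
  rw [← Finset.mul_sum]
  linarith

/-- A total variation bound without asymptotics, valid as soon as all Dirichlet parameters exceed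
`1`. -/
theorem tvDist_symmDirichlet_gaussian_le (hr : ∀ i, 0 < r i) (hr1 : ∑ i, r i = 1) (hA : 0 < A)
    (hc : ∀ i, 1 < A * r i) :
    tvDist (volume.withDensity fun x => ENNReal.ofReal (symmDirichletDensity (fun j => A * r j) x))
      (multivariateGaussian (WithLp.toLp 2 fun i => r i.castSucc)
        ((1 + A)⁻¹ • sigmaMat fun i => r i.castSucc)) ≤
      ENNReal.ofReal (2 * √(5 / 4 * ∑ i, 1 / (A * r i))) := by
  have hlt : ∑ i : Fin d, r i.castSucc < 1 := by
    have : ∑ i : Fin d, r i.castSucc + r (Fin.last d) = 1 := by rw [← hr1, Fin.sum_univ_castSucc]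
    linarith [hr (Fin.last d)]
  have hS : ((1 + A)⁻¹ • sigmaMat fun i => r i.castSucc).PosDef :=
    (posDef_sigmaMat (fun i => hr _) hlt).smul (by positivity)
  obtain ⟨gi, g1⟩ := integrable_gaussianDensity (WithLp.toLp 2 fun i => r i.castSucc) hS
  obtain ⟨hi, hle⟩ := integral_mul_logRatio_le hr hr1 hA hc
  rw [multivariateGaussian_eq_withDensity _ hS]
  refine tvDist_withDensity_le (symmDirichletDensity_nonneg fun i => mul_pos hA (hr i))
    (gaussianDensity_nonneg _ _) (integrable_symmDirichletDensity hc) gi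
    (integral_symmDirichletDensity hc) g1 (symmDirichletDensity_le hr hr1 hA hc) hi ?_ hle
  exact mul_pos (by norm_num) (Finset.sum_pos (fun i _ => one_div_pos.2 (mul_pos hA (hr i)))
    Finset.univ_nonempty)

/-- The maximum of the `d + 1` weights is at least `1 / (d + 1)`, which trades one factor `d + 1` for
it. -/
theorem sum_one_div_le (hr : ∀ i, 0 < r i) (hr1 : ∑ i, r i = 1) :
    ∑ i, 1 / r i ≤ ((d : ℝ) + 1) ^ 2 * ((⨆ i, r i) / ⨅ i, r i) := by
  have hbA : BddAbove (Set.range r) := (Set.finite_range r).bddAbove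
  have hbB : BddBelow (Set.range r) := (Set.finite_range r).bddBelow
  have hmin : 0 < ⨅ i, r i := by
    obtain ⟨i, hi⟩ := exists_eq_ciInf_of_finite (f := r)
    rw [← hi]; exact hr i
  have hmax : 1 ≤ ((d : ℝ) + 1) * ⨆ i, r i := by
    have := Finset.sum_le_sum fun i (_ : i ∈ Finset.univ) => le_ciSup hbA i
    rw [hr1] at this
    simpa using this
  calc ∑ i, 1 / r i ≤ ∑ _i : Fin (d + 1), 1 / ⨅ i, r i :=
        Finset.sum_le_sum fun i _ => one_div_le_one_div_of_le hmin (ciInf_le hbB i)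
    _ = ((d : ℝ) + 1) * 1 / ⨅ i, r i := by simp; ring
    _ ≤ ((d : ℝ) + 1) * (((d : ℝ) + 1) * ⨆ i, r i) / ⨅ i, r i := by gcongr
    _ = _ := by ring

end Comparison

theorem theorem2 :
    ∃ C : ℝ, 0 < C ∧
      ∀ d : ℕ, 1 ≤ d →
      ∀ (α : Fin d → ℝ) (β : ℝ), (∀ i, 0 < α i) → 0 < β →
        ∀ᶠ N : ℕ in atTop,
          tvDist (dirichletMeasure (fun i => (N : ℝ) * α i) ((N : ℝ) * β)) (normalApprox α β N) ≤
            ENNReal.ofReal (C * (Real.sqrt (epsN α β N) * ((d : ℝ) *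
              Real.sqrt ((⨆ i, meanVecExt α β i) / (⨅ i, meanVecExt α β i))))) := by
  refine ⟨2 * √5, by positivity, fun d hd α β hα hβ => ?_⟩
  set T : ℝ := ∑ j, α j + β with hT
  have hT0 : 0 < T := add_pos_of_nonneg_of_pos (Finset.sum_nonneg fun i _ => (hα i).le) hβ
  set r : Fin (d + 1) → ℝ := meanVecExt α β with hrdef
  have hrc : ∀ i : Fin d, r i.castSucc = α i / T := fun i => by
    simp [hrdef, meanVecExt, meanVec, hT]
  have hrl : r (Fin.last d) = β / T := by simp [hrdef, meanVecExt, hT]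
  have hr : ∀ i, 0 < r i := by
    intro i
    refine Fin.lastCases ?_ (fun i => ?_) i
    · rw [hrl]; positivity
    · rw [hrc]; exact div_pos (hα i) hT0
  have hr1 : ∑ i, r i = 1 := by
    rw [Fin.sum_univ_castSucc, hrl]
    simp_rw [hrc]
    rw [← Finset.sum_div, ← add_div, ← hT, div_self hT0.ne']
  have hN : ∀ᶠ N : ℕ in atTop, ∀ i, 1 < (N : ℝ) * T * r i := by
    rw [eventually_all]
    intro i
    have : Tendsto (fun N : ℕ => (N : ℝ) * (T * r i)) atTop atTop :=
      tendsto_natCast_atTop_atTop.atTop_mul_const (mul_pos hT0 (hr i))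
    filter_upwards [this.eventually_gt_atTop 1] with N hN
    rwa [mul_assoc]
  filter_upwards [hN, eventually_gt_atTop 0] with N hN hN0
  have hN0' : (0 : ℝ) < N := by exact_mod_cast hN0
  have hA : 0 < (N : ℝ) * T := mul_pos hN0' hT0
  have h := tvDist_symmDirichlet_gaussian_le hr hr1 hA hN
  have e1 : dirichletMeasure (fun i => (N : ℝ) * α i) ((N : ℝ) * β) =
      volume.withDensity fun x =>
        ENNReal.ofReal (symmDirichletDensity (fun j => (N : ℝ) * T * r j) x) := by
    rw [dirichletMeasure, dirichletDensity_eq_symm]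
    congr! 5 with _ j
    refine Fin.lastCases ?_ (fun j => ?_) j
    · rw [Fin.snoc_last, hrl]; field_simp
    · rw [Fin.snoc_castSucc, hrc]; field_simp
  have e2 : normalApprox α β N = multivariateGaussian (WithLp.toLp 2 fun i => r i.castSucc)
        ((1 + (N : ℝ) * T)⁻¹ • sigmaMat fun i => r i.castSucc) := by
    have : meanVec α β = fun i => r i.castSucc := by
      ext i; rw [hrc, meanVec]
    rw [normalApprox, this, epsN, one_div, inv_inv]
  rw [e1, e2]
  refine h.trans (ENNReal.ofReal_le_ofReal ?_)
  set Q : ℝ := (⨆ i, r i) / ⨅ i, r i with hQ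
  have hd1 : (1 : ℝ) ≤ d := by exact_mod_cast hd
  have hsum : 5 / 4 * ∑ i, 1 / ((N : ℝ) * T * r i) ≤ 5 * (epsN α β N * ((d : ℝ) ^ 2 * Q)) := by
    have hb := sum_one_div_le hr hr1
    have hQ0 : 0 ≤ Q := by
      have : 0 < ∑ i, 1 / r i :=
        Finset.sum_pos (fun i _ => one_div_pos.2 (hr i)) Finset.univ_nonempty
      have h3 : 0 < ((d : ℝ) + 1) ^ 2 * Q := this.trans_le hb
      exact ((pos_iff_pos_of_mul_pos h3).1 (by positivity)).le
    have e3 : ∑ i, 1 / ((N : ℝ) * T * r i) = epsN α β N * ∑ i, 1 / r i := by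
      rw [Finset.mul_sum]
      refine Finset.sum_congr rfl fun i _ => ?_
      rw [epsN, ← hT, one_div_mul_one_div]
    have he : 0 ≤ epsN α β N := by rw [epsN, ← hT]; positivity
    -- `d + 1 ≤ 2 d` costs a factor `4`
    have h4 : ((d : ℝ) + 1) ^ 2 ≤ 4 * (d : ℝ) ^ 2 := by nlinarith
    have h5 : ∑ i, 1 / r i ≤ 4 * (d : ℝ) ^ 2 * Q :=
      hb.trans (mul_le_mul_of_nonneg_right h4 hQ0)
    rw [e3]
    have := mul_le_mul_of_nonneg_left h5 he
    linarith
  calc 2 * √(5 / 4 * ∑ i, 1 / ((N : ℝ) * T * r i))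
      ≤ 2 * √(5 * (epsN α β N * ((d : ℝ) ^ 2 * Q))) := by gcongr
    _ = 2 * √5 * (√(epsN α β N) * (d * √Q)) := by
        have he : 0 ≤ epsN α β N := by rw [epsN, ← hT]; positivity
        rw [Real.sqrt_mul (by norm_num), Real.sqrt_mul he, Real.sqrt_mul (by positivity),
          Real.sqrt_sq (by positivity), mul_assoc]
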